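/- **Setting.** Let the price follow the geometric Brownian motion $dP_t=\mu P_t\,dt+\sigma P_t\,dW_t$ with $\sigma>0$, let $r>0$ be the interest rate, $\mu<r$, $Q>0$ the production, $T>0$ the contract duration, $I$ the investment cost, $F>0$ the tariff and (for the collar only) $C\ge F$ the price cap. For a scheme $S$ the profit flow during the contract is $\Pi_S(p,F,C)$, where $$\Pi_S=FQ\ \text{(fixed price)},\quad (p+F)Q\ \text{(fixed premium)},\quad \max(p,F)\,Q\ \text{(minimum price guarantee)},\quad \min(\max(p,F),C)\,Q\ \text{(collar)},$$ and the value of the project at the time of investment is $$V_S(p;F,C)=E\Big[\int_0^T e^{-rt}\Pi_S(P_t,F,C)\,dt+\int_T^\infty e^{-rt}P_tQ\,dt\ \Big|\ P_0=p\Big].$$ For $\lambda\ge 0$ let $\eta_1(\lambda)=\frac12-\frac{\mu}{\sigma^2}+\sqrt{\big(\frac{\mu}{\sigma^2}-\frac12\big)^2+\frac{2(r+\lambda)}{\sigma^2}}$ and $\beta_1=\eta_1(0)$. **Thresholds.** Without regulatory uncertainty, $P^*>0$ is an investment threshold for $(F,C)$, with waiting value $A\,p^{\beta_1}$, if value matching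 and smooth pasting hold: $A (P^*)^{\beta_1}=V_S(P^*;F,C)-I$ and $\beta_1A(P^*)^{\beta_1-1}=V_S'(P^*;F,C)$. Under regulatory uncertainty, before investment the tariff $F$ is reduced to $\omega F$ (and, for the collar, the cap $C$ to $\omega_CC$) at a Poisson time of intensity $\lambda>0$, where $\omega,\omega_C\in[0,1]$ and, for the collar, $\omega F\le\omega_CC$. Let $A^{(\omega)}$ and $P^{*(\omega)}$ be a constant and a threshold as above for the reduced contract $(\omega F,\omega_CC)$. An investment threshold under regulatory uncertainty is a $P_{SR}^*\in(0,P^{*(\omega)}]$ such that for some constant $B$ the waiting value $B\,p^{\eta_1}+A^{(\omega)}p^{\beta_1}$, with $\eta_1=\eta_1(\lambda)$, satisfies value matching and smooth pasting at $P_{SR}^*$: $$B (P_{SR}^*)^{\eta_1}+A^{(\omega)}(P_{SR}^*)^{\beta_1}=V_S(P_{SR}^*;F,C)-I,\qquad \eta_1B(P_{SR}^*)^{\eta_1-1}+\beta_1A^{(\omega)}(P_{SR}^*)^{\beta_1-1}=V_S'(P_{SR}^*;F,C).$$ (The restriction $P_{SR}^*\le P^{*(\omega)}$ expresses that the firm would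 still be waiting if the tariff had been reduced; the form of the waiting value presupposes it.) **Proposition.** For each of the four schemes, with all other parameters fixed: 1. The investment threshold under regulatory uncertainty decreases with $\lambda$: if $0<\lambda_1\le\lambda_2$ and $P_1,P_2$ are thresholds for $\lambda_1,\lambda_2$, then $P_2\le P_1$; and $P_2<P_1$ if moreover $\lambda_1<\lambda_2$ and the contract is really reduced, that is, $\omega<1$ (or, for the collar, $\omega<1$ or $\omega_C<1$). 2. The investment threshold under regulatory uncertainty strictly increases with $\omega$: if $0\le\omega_1<\omega_2\le1$ (with $\omega_2F\le\omega_CC$ for the collar) and $P_1,P_2$ are thresholds for $\omega_1,\omega_2$ with the same $\lambda>0$, then $P_1<P_2$. -/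

import Mathlib

/-- The data of the investment problem: drift `μ` and volatility `σ` of the energy price,
interest rate `r`, annual production `Q`, contract duration `T`, investment cost `I`. -/
structure Market where
  μ : ℝ
  σ : ℝ
  r : ℝ
  Q : ℝ
  T : ℝ
  I : ℝ

/-- The four feed-in tariff schemes. -/
inductive Scheme where
  | fixedPrice
  | fixedPremium
  | minPriceGuarantee
  | collar

/-- The instantaneous profit `Π_S` during the contract at the price `p`, when the tariff is `F`
and the price cap is `C`. The cap plays a role for the collar only. -/
noncomputable def Scheme.profit (Q F C p : ℝ) : Scheme → ℝ
  | .fixedPrice => F * Q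
  | .fixedPremium => (p + F) * Q
  | .minPriceGuarantee => max p F * Q
  | .collar => min (max p F) C * Q

namespace Market

/-- The price at time `t` of the geometric Brownian motion `dP = μ P dt + σ P dW` with `P₀ = p`,
as a function of the standard normal variable `z = W_t / √t`. -/
noncomputable def price (m : Market) (p t z : ℝ) : ℝ :=
  p * Real.exp ((m.μ - m.σ ^ 2 / 2) * t + m.σ * √t * z)

/-- The expectation `E[g(P_t) | P₀ = p]`. -/
noncomputable def expect (m : Market) (g : ℝ → ℝ) (p t : ℝ) : ℝ :=
  ∫ z, g (m.price p t z) ∂(ProbabilityTheory.gaussianReal 0 1)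

/-- The project value `V_S(p)`: the expected discounted profit of a firm that invests at the
price `p`, namely the contract profit during `[0, T]` and the market profit `P_t Q` afterwards.
(All profits are nonnegative, so that expectation and time integral may be exchanged.) -/
noncomputable def projectValue (m : Market) (S : Scheme) (F C p : ℝ) : ℝ :=
  (∫ t in (0 : ℝ)..m.T, Real.exp (-m.r * t) * m.expect (fun x => S.profit m.Q F C x) p t) +
    ∫ t in Set.Ioi m.T, Real.exp (-m.r * t) * m.expect (fun x => x * m.Q) p t

/-- The positive root `η₁` of `σ²/2 η (η - 1) + μ η - (r + lam) = 0`. -/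
noncomputable def eta (m : Market) (lam : ℝ) : ℝ :=
  1 / 2 - m.μ / m.σ ^ 2 + √((-1 / 2 + m.μ / m.σ ^ 2) ^ 2 + 2 * (m.r + lam) / m.σ ^ 2)

/-- The positive root `β₁` of `σ²/2 β (β - 1) + μ β - r = 0`. -/
noncomputable def beta (m : Market) : ℝ :=
  1 / 2 - m.μ / m.σ ^ 2 + √((-1 / 2 + m.μ / m.σ ^ 2) ^ 2 + 2 * m.r / m.σ ^ 2)

/-- `P` is the investment threshold, and `p ↦ A p ^ β₁` the value of waiting below it, when the
tariff `F` and the cap `C` are certain: value matching and smooth pasting hold at `P`. -/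
structure IsThreshold (m : Market) (S : Scheme) (F C A P : ℝ) : Prop where
  pos : 0 < P
  value_matching : A * P ^ m.beta = m.projectValue S F C P - m.I
  smooth_pasting :
    HasDerivAt (m.projectValue S F C) (m.beta * A * P ^ (m.beta - 1)) P

/-- `P` is the investment threshold under regulatory uncertainty: before investment the tariff
and the cap `(F, C)` are replaced by `(ω F, ωC C)` at rate `lam`. Here `p ↦ A p ^ β₁` is the value
of waiting, below the threshold `P'`, once the reduction has taken place. The value of waiting
before the reduction is `p ↦ B p ^ η₁ + A p ^ β₁` on `(0, P)`, which presupposes that `(0, P)` lies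
in the waiting region `(0, P')` of the reduced contract; value matching and smooth pasting
hold at `P`. -/
def IsRegThreshold (m : Market) (S : Scheme) (F C ω ωC lam P : ℝ) : Prop :=
  ∃ A P' B : ℝ,
    m.IsThreshold S (ω * F) (ωC * C) A P' ∧
    0 < P ∧ P ≤ P' ∧
    B * P ^ m.eta lam + A * P ^ m.beta = m.projectValue S F C P - m.I ∧
    HasDerivAt (m.projectValue S F C)
      (m.eta lam * B * P ^ (m.eta lam - 1) + m.beta * A * P ^ (m.beta - 1)) P

end Market

/-! Write `V` for the value of the full contract, `β`, `η` for `m.beta`, `m.eta lam`, and put `W(p)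
= p V'(p) - β V(p)`. Everything rests on `W` being strictly decreasing (`strictAntiOn_defect`).

For a constant `A` let `u = V - I - A p^β`. Since `W` decreases, so does `p u' / p^β`, and `u` is
strictly increasing as long as `u' ≥ 0` and strictly decreasing afterwards. Hence value matching and
smooth pasting at an ordinary threshold say that `u` has maximum `0` there: `A` is the least
constant with `A p^β ≥ V - I`, so it is unique and increases with the contract.

Under regulatory uncertainty, with `A` from the reduced contract, eliminating `B` gives `P u'(P) = η
u(P)`, that is, `(η - β) u(P) = W(P) + β I`. The restriction `P ≤ P'` forces `u'(P) ≥ 0`, so at and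
below such a threshold `u` increases while `W` decreases. A larger `lam` raises `η` and moves the
crossing to the left; a larger `ω` raises `A`, lowers `u` and moves it to the right.

That `W` decreases follows in `x = log p` from the factorization `σ²/2 (d/dx - β)(d/dx + κ)` of the
generator minus `r`: applying `d/dx - β` to the value leaves a negative multiple of averages of the
monotone functions `f` and `p Q - f`. -/

open MeasureTheory ProbabilityTheory Set Filter Topology

/-! ### Exponential growth and Gaussian integrability -/

/-- `g` grows at most exponentially. -/
def ExpGrowth (g : ℝ → ℝ) : Prop :=
  ∃ C c : ℝ, 0 ≤ C ∧ 0 ≤ c ∧ ∀ x, |g x| ≤ C * Real.exp (c * |x|)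

namespace ExpGrowth

variable {f g : ℝ → ℝ}

lemma const_mul (hf : ExpGrowth f) (a : ℝ) : ExpGrowth (fun x => a * f x) := by
  obtain ⟨C, c, hC, hc, h⟩ := hf
  refine ⟨|a| * C, c, by positivity, hc, fun x => ?_⟩
  rw [abs_mul, mul_assoc]
  exact mul_le_mul_of_nonneg_left (h x) (abs_nonneg a)

lemma add (hf : ExpGrowth f) (hg : ExpGrowth g) : ExpGrowth (fun x => f x + g x) := by
  obtain ⟨C, c, hC, hc, h⟩ := hf
  obtain ⟨D, d, hD, hd, h'⟩ := hg
  refine ⟨C + D, c + d, by positivity, by positivity, fun x => (abs_add_le _ _).trans ?_⟩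
  rw [add_mul]
  refine add_le_add ((h x).trans ?_) ((h' x).trans ?_)
  · gcongr; linarith
  · gcongr; linarith

lemma exp : ExpGrowth Real.exp :=
  ⟨1, 1, zero_le_one, zero_le_one, fun x => by
    rw [Real.abs_exp, one_mul, one_mul]; exact Real.exp_le_exp.2 (le_abs_self x)⟩

/-- A bound for `g` at the point `a + b z`, locally uniform in `a` and `b`. -/
lemma bound_affine (hg : ExpGrowth g) (K L : ℝ) :
    ∃ C c : ℝ, 0 ≤ C ∧ 0 ≤ c ∧
      ∀ a b z : ℝ, |a| ≤ K → |b| ≤ L → |g (a + b * z)| ≤ C * Real.exp (c * |z|) := by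
  obtain ⟨C, c, hC, hc, h⟩ := hg
  refine ⟨C * Real.exp (c * |K|), c * |L|, by positivity, by positivity, fun a b z ha hb => ?_⟩
  refine (h _).trans ?_
  rw [mul_assoc, ← Real.exp_add]
  have h1 : |a + b * z| ≤ |K| + |L| * |z| := by
    refine (abs_add_le _ _).trans (add_le_add (ha.trans (le_abs_self K)) ?_)
    rw [abs_mul]
    exact mul_le_mul_of_nonneg_right (hb.trans (le_abs_self L)) (abs_nonneg z)
  gcongr
  calc c * |a + b * z| ≤ c * (|K| + |L| * |z|) := by gcongr
    _ = _ := by ring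

end ExpGrowth

lemma integrable_exp_mul_abs_gaussianReal (c : ℝ) :
    Integrable (fun z => Real.exp (c * |z|)) (gaussianReal 0 1) :=
  integrable_exp_mul_abs (X := fun z : ℝ => z) (integrable_exp_mul_gaussianReal c)
    (integrable_exp_mul_gaussianReal (-c))

lemma abs_mul_exp_le (c z : ℝ) : |z| * Real.exp (c * |z|) ≤ Real.exp ((c + 1) * |z|) := by
  rw [add_mul, Real.exp_add, one_mul, mul_comm]
  gcongr
  linarith [Real.add_one_le_exp |z|]

lemma integrable_of_expGrowth {g : ℝ → ℝ} (hc : Continuous g) (hg : ExpGrowth g) (a b : ℝ) :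
    Integrable (fun z => g (a + b * z)) (gaussianReal 0 1) := by
  obtain ⟨C, c, -, -, h⟩ := hg.bound_affine |a| |b|
  refine ((integrable_exp_mul_abs_gaussianReal c).const_mul C).mono'
    (by fun_prop) (ae_of_all _ fun z => ?_)
  exact h a b z le_rfl le_rfl

lemma integrable_mul_of_expGrowth {g : ℝ → ℝ} (hc : Continuous g) (hg : ExpGrowth g) (a b : ℝ) :
    Integrable (fun z => z * g (a + b * z)) (gaussianReal 0 1) := by
  obtain ⟨C, c, hC, -, h⟩ := hg.bound_affine |a| |b|
  refine ((integrable_exp_mul_abs_gaussianReal (c + 1)).const_mul C).mono'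
    (by fun_prop) (ae_of_all _ fun z => ?_)
  rw [Real.norm_eq_abs, abs_mul]
  calc |z| * |g (a + b * z)| ≤ |z| * (C * Real.exp (c * |z|)) := by
        gcongr; exact h a b z le_rfl le_rfl
    _ = C * (|z| * Real.exp (c * |z|)) := by ring
    _ ≤ _ := by gcongr; exact abs_mul_exp_le c z

/-! ### Gaussian integration by parts -/

lemma gaussianPDFReal_zero_one (z : ℝ) :
    gaussianPDFReal 0 1 z = (√(2 * Real.pi))⁻¹ * Real.exp (-z ^ 2 / 2) := by
  simp [gaussianPDFReal]

lemma hasDerivAt_gaussianPDFReal_zero_one (z : ℝ) :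
    HasDerivAt (gaussianPDFReal 0 1) (-(z * gaussianPDFReal 0 1 z)) z := by
  have h : gaussianPDFReal 0 1 = fun z => (√(2 * Real.pi))⁻¹ * Real.exp (-z ^ 2 / 2) :=
    funext gaussianPDFReal_zero_one
  rw [h]
  have h1 : HasDerivAt (fun z : ℝ => -z ^ 2 / 2) (-z) z := by
    have := ((hasDerivAt_pow 2 z).neg).div_const 2
    exact this.congr_deriv (by norm_num; ring)
  exact ((h1.exp).const_mul (√(2 * Real.pi))⁻¹).congr_deriv (by ring)

lemma integrable_gaussianReal_iff {g : ℝ → ℝ} :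
    Integrable g (gaussianReal 0 1) ↔ Integrable (fun z => gaussianPDFReal 0 1 z * g z) := by
  rw [gaussianReal_of_var_ne_zero 0 one_ne_zero,
    integrable_withDensity_iff_integrable_smul' (measurable_gaussianPDF 0 1)
      (ae_of_all _ fun _ => ENNReal.ofReal_lt_top)]
  simp only [toReal_gaussianPDF, smul_eq_mul]

/-- **Stein's lemma**. -/
lemma integral_mul_gaussianReal {h h' : ℝ → ℝ} (hd : ∀ x, HasDerivAt h (h' x) x)
    (i0 : Integrable h (gaussianReal 0 1)) (i1 : Integrable h' (gaussianReal 0 1))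
    (i2 : Integrable (fun z => z * h z) (gaussianReal 0 1)) :
    ∫ z, z * h z ∂gaussianReal 0 1 = ∫ z, h' z ∂gaussianReal 0 1 := by
  rw [integrable_gaussianReal_iff] at i0 i1 i2
  rw [integral_gaussianReal_eq_integral_smul one_ne_zero,
    integral_gaussianReal_eq_integral_smul one_ne_zero]
  have := integral_mul_deriv_eq_deriv_mul_of_integrable (u := gaussianPDFReal 0 1) (v := h)
    (fun x _ => hasDerivAt_gaussianPDFReal_zero_one x) (fun x _ => hd x) i1
    (by refine i2.neg.congr (ae_of_all _ fun z => ?_)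
        simp only [Pi.neg_apply, Pi.mul_apply]; ring) i0
  simp only [smul_eq_mul]
  rw [this, ← integral_neg]
  congr 1
  ext z
  ring

/-! ### Gaussian averages: Kolmogorov equation and Dynkin formula -/

/-- The mean of `g (X_t)` for the Brownian motion `X` with drift `ν` and volatility `σ` that
starts from `x`. -/
noncomputable def gaussAvg (ν σ : ℝ) (g : ℝ → ℝ) (t x : ℝ) : ℝ :=
  ∫ z, g (x + ν * t + σ * √t * z) ∂gaussianReal 0 1

section gaussAvg

variable {ν σ : ℝ} {g g' g'' : ℝ → ℝ}

@[simp] lemma gaussAvg_zero (x : ℝ) : gaussAvg ν σ g 0 x = g x := by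
  simp [gaussAvg]

lemma abs_drift_le {t R x : ℝ} (ht : |t| ≤ R) : |x + ν * t| ≤ |x| + |ν| * R := by
  refine (abs_add_le _ _).trans ?_
  rw [abs_mul]
  gcongr

lemma abs_vol_le {t R : ℝ} (ht : |t| ≤ R) : |σ * √t| ≤ |σ| * √R := by
  rw [abs_mul, abs_of_nonneg (Real.sqrt_nonneg t)]
  gcongr
  exact (le_abs_self t).trans ht

lemma continuous_gaussAvg (hc : Continuous g) (hg : ExpGrowth g) (x : ℝ) :
    Continuous fun t => gaussAvg ν σ g t x := by
  refine continuous_iff_continuousAt.2 fun t₀ => ?_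
  obtain ⟨C, c, -, -, h⟩ := hg.bound_affine (|x| + |ν| * (|t₀| + 1)) (|σ| * √(|t₀| + 1))
  have hev : ∀ᶠ t in 𝓝 t₀, |t| ≤ |t₀| + 1 :=
    (continuous_abs.continuousAt.eventually_lt continuousAt_const (lt_add_one |t₀|)).mono
      fun _ => le_of_lt
  refine continuousAt_of_dominated (bound := fun z => C * Real.exp (c * |z|))
    (Eventually.of_forall fun t => by fun_prop) (hev.mono fun t ht => ae_of_all _ fun z => ?_)
    ((integrable_exp_mul_abs_gaussianReal c).const_mul C) (ae_of_all _ fun z => by fun_prop)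
  exact h _ _ z (abs_drift_le ht) (abs_vol_le ht)

lemma hasDerivAt_gaussAvg_space (hd : ∀ x, HasDerivAt g (g' x) x) (hc' : Continuous g')
    (hg : ExpGrowth g) (hg' : ExpGrowth g') (t x₀ : ℝ) :
    HasDerivAt (gaussAvg ν σ g t) (gaussAvg ν σ g' t x₀) x₀ := by
  have hc : Continuous g := continuous_iff_continuousAt.2 fun x => (hd x).continuousAt
  obtain ⟨C, c, -, -, h⟩ := hg'.bound_affine (|x₀| + 1 + |ν| * |t|) (|σ| * √|t|)
  refine (hasDerivAt_integral_of_dominated_loc_of_deriv_le (Metric.ball_mem_nhds x₀ one_pos)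
    (bound := fun z => C * Real.exp (c * |z|))
    (F := fun x z => g (x + ν * t + σ * √t * z)) (F' := fun x z => g' (x + ν * t + σ * √t * z))
    (Eventually.of_forall fun x => by fun_prop)
    (integrable_of_expGrowth hc hg _ _) (by fun_prop) (ae_of_all _ fun z x hx => ?_)
    ((integrable_exp_mul_abs_gaussianReal c).const_mul C) (ae_of_all _ fun z x _ => ?_)).2
  · refine h _ _ z ((abs_drift_le le_rfl).trans ?_) (abs_vol_le le_rfl)
    have : |x - x₀| < 1 := hx
    have := abs_sub_abs_le_abs_sub x x₀
    linarith
  · have := (hd (x + ν * t + σ * √t * z)).comp x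
      (((hasDerivAt_id x).add_const (ν * t)).add_const (σ * √t * z))
    exact this.congr_deriv (mul_one _)

/-- The Kolmogorov equation for Brownian motion with drift. -/
lemma hasDerivAt_gaussAvg_time (hd : ∀ x, HasDerivAt g (g' x) x)
    (hd' : ∀ x, HasDerivAt g' (g'' x) x) (hc'' : Continuous g'')
    (hg : ExpGrowth g) (hg' : ExpGrowth g') (hg'' : ExpGrowth g'') {t₀ : ℝ} (ht₀ : 0 < t₀)
    (x : ℝ) :
    HasDerivAt (fun t => gaussAvg ν σ g t x)
      (gaussAvg ν σ (fun y => σ ^ 2 / 2 * g'' y + ν * g' y) t₀ x) t₀ := by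
  have hc : Continuous g := continuous_iff_continuousAt.2 fun x => (hd x).continuousAt
  have hc' : Continuous g' := continuous_iff_continuousAt.2 fun x => (hd' x).continuousAt
  obtain ⟨C, c, hC, hc0, h⟩ :=
    hg'.bound_affine (|x| + |ν| * (2 * t₀)) (|σ| * √(2 * t₀))
  -- Bounds the derivative of `σ√t` uniformly over the interval `(t₀/2, 2t₀)`, which stays away from
  -- the singularity at `0`.
  set κ := |σ| / (2 * √(t₀ / 2)) with hκ
  have hκ0 : 0 ≤ κ := by positivity
  have key := (hasDerivAt_integral_of_dominated_loc_of_deriv_le (μ := gaussianReal 0 1)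
    (Ioo_mem_nhds (a := t₀ / 2) (b := 2 * t₀) (x := t₀) (by linarith) (by linarith))
    (bound := fun z => (|ν| + κ) * C * Real.exp ((c + 1) * |z|))
    (F := fun t z => g (x + ν * t + σ * √t * z))
    (F' := fun t z => g' (x + ν * t + σ * √t * z) * (ν + σ * (1 / (2 * √t)) * z))
    (Eventually.of_forall fun t => by fun_prop)
    (integrable_of_expGrowth hc hg _ _) (by fun_prop) (ae_of_all _ fun z t ht => ?_)
    ((integrable_exp_mul_abs_gaussianReal (c + 1)).const_mul _)
    (ae_of_all _ fun z t ht => ?_)).2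
  · refine key.congr_deriv ?_
    set a := x + ν * t₀
    set b := σ * √t₀
    have hs : 0 < √t₀ := Real.sqrt_pos.2 ht₀
    -- Differentiating `σ√t z` in time leaves a factor `z`; Stein's lemma trades it for the second
    -- derivative, and `σ/(2√t₀) · σ√t₀ = σ²/2`.
    have hst : ∫ z, z * g' (a + b * z) ∂gaussianReal 0 1
        = ∫ z, b * g'' (a + b * z) ∂gaussianReal 0 1 := by
      refine integral_mul_gaussianReal (fun z => ?_) (integrable_of_expGrowth hc' hg' a b)
        ((integrable_of_expGrowth hc'' hg'' a b).const_mul b)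
        (integrable_mul_of_expGrowth hc' hg' a b)
      have := (hd' (a + b * z)).comp z (((hasDerivAt_id z).const_mul b).const_add a)
      exact this.congr_deriv (by rw [mul_one, mul_comm])
    have e : ∀ z, g' (a + b * z) * (ν + σ * (1 / (2 * √t₀)) * z)
        = ν * g' (a + b * z) + σ / (2 * √t₀) * (z * g' (a + b * z)) := fun z => by ring
    rw [integral_congr_ae (ae_of_all _ e), integral_add ((integrable_of_expGrowth hc' hg' a b).const_mul ν)
      ((integrable_mul_of_expGrowth hc' hg' a b).const_mul _), integral_const_mul,
      integral_const_mul, hst, integral_const_mul, gaussAvg,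
      integral_add ((integrable_of_expGrowth hc'' hg'' a b).const_mul _)
        ((integrable_of_expGrowth hc' hg' a b).const_mul ν), integral_const_mul,
      integral_const_mul]
    have : σ / (2 * √t₀) * b = σ ^ 2 / 2 := by
      simp only [b]; field_simp
    rw [← mul_assoc, this, add_comm]
  · have ht0 : 0 < t := by linarith [ht.1]
    have hta : |t| ≤ 2 * t₀ := by rw [abs_of_pos ht0]; exact ht.2.le
    rw [Real.norm_eq_abs, abs_mul]
    have h1 := h _ _ z (abs_drift_le hta (ν := ν) (x := x)) (abs_vol_le hta (σ := σ))
    have h2 : |ν + σ * (1 / (2 * √t)) * z| ≤ (|ν| + κ) * Real.exp |z| := by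
      have h3 : |σ * (1 / (2 * √t))| ≤ κ := by
        have hs : 0 < √t := Real.sqrt_pos.2 ht0
        have hs2 : 0 < √(t₀ / 2) := Real.sqrt_pos.2 (by linarith)
        rw [abs_mul, abs_of_nonneg (by positivity : 0 ≤ 1 / (2 * √t)), mul_one_div, hκ]
        gcongr
        exact ht.1.le
      have h4 : |z| + 1 ≤ Real.exp |z| := Real.add_one_le_exp _
      calc |ν + σ * (1 / (2 * √t)) * z| ≤ |ν| + |σ * (1 / (2 * √t))| * |z| := by
            rw [← abs_mul]; exact abs_add_le _ _
        _ ≤ |ν| * Real.exp |z| + κ * Real.exp |z| := by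
            refine add_le_add (le_mul_of_one_le_right (abs_nonneg ν) ?_) ?_
            · linarith [abs_nonneg z]
            · gcongr; linarith
        _ = _ := by ring
    calc _ ≤ C * Real.exp (c * |z|) * ((|ν| + κ) * Real.exp |z|) := by gcongr
      _ = _ := by rw [add_mul c, Real.exp_add, one_mul]; ring
  · have ht0 : 0 < t := by linarith [ht.1]
    refine (hd (x + ν * t + σ * √t * z)).comp t ?_
    have := ((((hasDerivAt_id t).const_mul ν).const_add x)).add
      (((Real.hasDerivAt_sqrt ht0.ne').const_mul σ).mul_const z)
    exact this.congr_deriv (by rw [mul_one])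

/-- **Dynkin's formula** for the discounted resolvent equation. -/
lemma integral_discounted_gaussAvg (hd : ∀ x, HasDerivAt g (g' x) x)
    (hd' : ∀ x, HasDerivAt g' (g'' x) x) (hc'' : Continuous g'')
    (hg : ExpGrowth g) (hg' : ExpGrowth g') (hg'' : ExpGrowth g'') (r : ℝ) {f : ℝ → ℝ}
    (hf : ∀ x, σ ^ 2 / 2 * g'' x + ν * g' x - r * g x = -f x) {T : ℝ} (hT : 0 ≤ T) (x : ℝ) :
    ∫ t in (0 : ℝ)..T, Real.exp (-r * t) * gaussAvg ν σ f t x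
      = g x - Real.exp (-r * T) * gaussAvg ν σ g T x := by
  have hc : Continuous g := continuous_iff_continuousAt.2 fun x => (hd x).continuousAt
  have hc' : Continuous g' := continuous_iff_continuousAt.2 fun x => (hd' x).continuousAt
  have hf' : f = fun x => (-1) * (σ ^ 2 / 2 * g'' x + ν * g' x) + r * g x := by
    ext x; linarith [hf x]
  have hfc : Continuous f := by rw [hf']; fun_prop
  have hfg : ExpGrowth f := by
    rw [hf']
    exact (((hg''.const_mul _).add (hg'.const_mul _)).const_mul _).add (hg.const_mul _)
  have hcf := continuous_gaussAvg (ν := ν) (σ := σ) hfc hfg x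
  have hcg := continuous_gaussAvg (ν := ν) (σ := σ) hc hg x
  -- The time derivative is known only for `t > 0`; continuity covers the endpoint `0`.
  have key := intervalIntegral.integral_eq_sub_of_hasDerivAt_of_le hT
    (f := fun t => -(Real.exp (-r * t) * gaussAvg ν σ g t x))
    (f' := fun t => Real.exp (-r * t) * gaussAvg ν σ f t x)
    (by fun_prop) (fun t ht => ?_) (Continuous.intervalIntegrable (by fun_prop) _ _)
  · rw [key]; simp; ring
  · have h1 : HasDerivAt (fun t => Real.exp (-r * t)) (Real.exp (-r * t) * (-r)) t := by
      simpa using ((hasDerivAt_id t).const_mul (-r)).exp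
    have h2 := (h1.mul (hasDerivAt_gaussAvg_time (ν := ν) (σ := σ) hd hd' hc'' hg hg' hg''
      ht.1 x)).neg
    refine h2.congr_deriv ?_
    have h3 : gaussAvg ν σ f t x
        = -gaussAvg ν σ (fun y => σ ^ 2 / 2 * g'' y + ν * g' y) t x + r * gaussAvg ν σ g t x := by
      have iA : Integrable (fun z => (fun y => σ ^ 2 / 2 * g'' y + ν * g' y)
          (x + ν * t + σ * √t * z)) (gaussianReal 0 1) :=
        integrable_of_expGrowth (g := fun y => σ ^ 2 / 2 * g'' y + ν * g' y) (by fun_prop)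
          ((hg''.const_mul _).add (hg'.const_mul _)) _ _
      have iB := integrable_of_expGrowth hc hg (x + ν * t) (σ * √t)
      simp only [gaussAvg]
      rw [← integral_neg, ← integral_const_mul]
      refine Eq.trans ?_ (integral_add iA.neg (iB.const_mul r))
      congr 1
      ext z
      simp only [hf']
      ring
    rw [h3]
    ring

end gaussAvg

/-! ### Payoffs and the two first-order factors of the resolvent equation -/

/-- A profit that increases with the price `p`, at a rate of at most `Q`. -/
structure IsPayoff (Q : ℝ) (f : ℝ → ℝ) : Prop where
  mono : Monotone f
  gap : Monotone fun p => p * Q - f p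

namespace IsPayoff

variable {Q : ℝ} {f : ℝ → ℝ}

lemma abs_sub_le (hf : IsPayoff Q f) (p q : ℝ) : |f p - f q| ≤ Q * |p - q| := by
  wlog h : p ≤ q generalizing p q
  · rw [abs_sub_comm, abs_sub_comm p]
    exact this q p (le_of_not_ge h)
  have h1 := hf.mono h
  have h2 := hf.gap h
  simp only at h2
  rw [abs_of_nonpos (by linarith), abs_of_nonpos (by linarith)]
  linarith

lemma continuous (hf : IsPayoff Q f) (hQ : 0 ≤ Q) : Continuous f :=
  (LipschitzWith.of_dist_le_mul (K := Q.toNNReal) fun p q => by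
    simpa [Real.dist_eq, hQ] using hf.abs_sub_le p q).continuous

lemma abs_exp_le (hf : IsPayoff Q f) (x : ℝ) :
    |f (Real.exp x)| ≤ |f 0| + Q * Real.exp x := by
  have h := hf.abs_sub_le (Real.exp x) 0
  rw [sub_zero, Real.abs_exp] at h
  have := abs_sub_abs_le_abs_sub (f (Real.exp x)) (f 0)
  linarith

end IsPayoff

lemma expGrowth_of_le {g : ℝ → ℝ} {a b : ℝ} (ha : 0 ≤ a) (hb : 0 ≤ b)
    (h : ∀ x, |g x| ≤ a + b * Real.exp x) : ExpGrowth g := by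
  refine ⟨a + b, 1, by positivity, zero_le_one, fun x => (h x).trans ?_⟩
  rw [one_mul, add_mul]
  refine add_le_add (le_mul_of_one_le_right ha (Real.one_le_exp (abs_nonneg x))) ?_
  gcongr
  exact le_abs_self x

/-- The average of `g` over `(-∞, x]` with an exponential weight. -/
noncomputable def kernelAvg (k : ℝ) (g : ℝ → ℝ) (x : ℝ) : ℝ :=
  ∫ y in Iic (0 : ℝ), Real.exp (k * y) * g (x + y)

section kernelAvg

variable {k a b : ℝ} {g : ℝ → ℝ}

lemma integrableOn_exp_mul_bound (hk : 0 < k) (x c : ℝ) :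
    IntegrableOn (fun y => a * Real.exp (k * y) + b * Real.exp x * Real.exp ((k + 1) * y))
      (Iic c) :=
  ((integrableOn_exp_mul_Iic hk c).const_mul a).add
    ((integrableOn_exp_mul_Iic (by linarith : 0 < k + 1) c).const_mul _)

lemma norm_exp_mul_le (h : ∀ x, |g x| ≤ a + b * Real.exp x) (x y : ℝ) :
    ‖Real.exp (k * y) * g (x + y)‖
      ≤ a * Real.exp (k * y) + b * Real.exp x * Real.exp ((k + 1) * y) := by
  rw [Real.norm_eq_abs, abs_mul, Real.abs_exp]
  refine (mul_le_mul_of_nonneg_left (h _) (Real.exp_pos _).le).trans (le_of_eq ?_)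
  rw [add_mul k, Real.exp_add x, Real.exp_add, one_mul]
  ring

lemma integrableOn_exp_mul (hk : 0 < k) (hc : Continuous g)
    (h : ∀ x, |g x| ≤ a + b * Real.exp x) (x c : ℝ) :
    IntegrableOn (fun y => Real.exp (k * y) * g (x + y)) (Iic c) :=
  (integrableOn_exp_mul_bound (a := a) (b := b) hk x c).mono'
    (by fun_prop) (ae_of_all _ fun y => norm_exp_mul_le h x y)

lemma abs_kernelAvg_le (hk : 0 < k) (h : ∀ x, |g x| ≤ a + b * Real.exp x) (x : ℝ) :
    |kernelAvg k g x| ≤ a / k + b / (k + 1) * Real.exp x := by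
  have hk1 : 0 < k + 1 := by linarith
  refine (norm_integral_le_of_norm_le (integrableOn_exp_mul_bound (a := a) (b := b) hk x 0)
    (ae_of_all _ fun y => norm_exp_mul_le h x y)).trans (le_of_eq ?_)
  rw [integral_add ((integrableOn_exp_mul_Iic hk 0).const_mul a)
    ((integrableOn_exp_mul_Iic hk1 0).const_mul _), integral_const_mul, integral_const_mul,
    integral_exp_mul_Iic hk, integral_exp_mul_Iic hk1]
  simp
  ring

/-- The substitution moves `x` from the argument of `g` into the limit of integration, so that
differentiating in `x` needs only continuity of `g`; payoffs have kinks. -/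
lemma kernelAvg_eq (k : ℝ) (g : ℝ → ℝ) (x : ℝ) :
    kernelAvg k g x = Real.exp (-k * x) * ∫ y in Iic x, Real.exp (k * y) * g y := by
  have h := (measurePreserving_add_left volume x).setIntegral_preimage_emb
    (measurableEmbedding_addLeft x) (fun y => Real.exp (k * y) * g y) (Iic x)
  have hs : (fun y => x + y) ⁻¹' Iic x = Iic 0 := by ext y; simp
  rw [hs] at h
  rw [← h, ← integral_const_mul, kernelAvg]
  congr 1
  ext y
  rw [← mul_assoc, ← Real.exp_add]
  congr 2
  ring

lemma hasDerivAt_kernelAvg (hk : 0 < k) (hc : Continuous g)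
    (h : ∀ x, |g x| ≤ a + b * Real.exp x) (x : ℝ) :
    HasDerivAt (kernelAvg k g) (g x - k * kernelAvg k g x) x := by
  have hi : ∀ c, IntegrableOn (fun y => Real.exp (k * y) * g y) (Iic c) := fun c => by
    simpa using integrableOn_exp_mul hk hc h 0 c
  have hcont : Continuous fun y => Real.exp (k * y) * g y := by fun_prop
  have h1 : (fun x => ∫ y in Iic x, Real.exp (k * y) * g y)
      = fun x => (∫ y in Iic (0 : ℝ), Real.exp (k * y) * g y)
        + ∫ y in (0 : ℝ)..x, Real.exp (k * y) * g y := by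
    ext c
    rw [← intervalIntegral.integral_Iic_sub_Iic (hi 0) (hi c)]
    ring
  have h2 : HasDerivAt (fun x => ∫ y in Iic x, Real.exp (k * y) * g y)
      (Real.exp (k * x) * g x) x := by
    rw [h1]
    exact (hcont.integral_hasStrictDerivAt 0 x).hasDerivAt.const_add _
  have h3 : HasDerivAt (fun x => Real.exp (-k * x)) (Real.exp (-k * x) * (-k)) x := by
    simpa using ((hasDerivAt_id x).const_mul (-k)).exp
  have h4 := h3.mul h2
  rw [show kernelAvg k g = fun x => Real.exp (-k * x) * ∫ y in Iic x, Real.exp (k * y) * g y from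
    funext (kernelAvg_eq k g)]
  refine h4.congr_deriv ?_
  have : Real.exp (-k * x) * Real.exp (k * x) = 1 := by rw [← Real.exp_add]; simp
  linear_combination g x * this

lemma kernelAvg_mono (hk : 0 < k) (hc : Continuous g)
    (h : ∀ x, |g x| ≤ a + b * Real.exp x) (hm : Monotone g) : Monotone (kernelAvg k g) := by
  intro x y hxy
  refine integral_mono (integrableOn_exp_mul hk hc h x 0) (integrableOn_exp_mul hk hc h y 0)
    fun s => mul_le_mul_of_nonneg_left (hm (by linarith)) (Real.exp_pos _).le

/-- The exponential is an eigenfunction of the averaging, with eigenvalue `1/(k+1)`. The right-hand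
side is thereby an average of the gap `p Q - f(p)`, which makes it monotone. -/
lemma kernelAvg_const_mul_exp_sub (hk : 0 < k) (hc : Continuous g)
    (h : ∀ x, |g x| ≤ a + b * Real.exp x) (Q x : ℝ) :
    kernelAvg k (fun y => Real.exp y * Q - g y) x
      = Q / (k + 1) * Real.exp x - kernelAvg k g x := by
  have hk1 : 0 < k + 1 := by linarith
  have h1 : ∀ y, Real.exp (k * y) * (Real.exp (x + y) * Q - g (x + y))
      = Q * Real.exp x * Real.exp ((k + 1) * y) - Real.exp (k * y) * g (x + y) := fun y => by
    rw [add_mul k, Real.exp_add x, Real.exp_add, one_mul]; ring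
  simp only [kernelAvg, h1]
  rw [integral_sub ((integrableOn_exp_mul_Iic hk1 0).const_mul _) (integrableOn_exp_mul hk hc h x 0),
    integral_const_mul, integral_exp_mul_Iic hk1]
  simp
  ring

end kernelAvg

/-- A solution `w` of `w' = β w + g`. -/
noncomputable def expConv (β : ℝ) (g : ℝ → ℝ) (x : ℝ) : ℝ :=
  Real.exp (β * x) * ∫ y in (0 : ℝ)..x, Real.exp (-β * y) * g y

lemma hasDerivAt_expConv (β : ℝ) {g : ℝ → ℝ} (hc : Continuous g) (x : ℝ) :
    HasDerivAt (expConv β g) (β * expConv β g x + g x) x := by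
  have hcont : Continuous fun y => Real.exp (-β * y) * g y := by fun_prop
  have h3 : HasDerivAt (fun x => Real.exp (β * x)) (Real.exp (β * x) * β) x := by
    simpa using ((hasDerivAt_id x).const_mul β).exp
  refine (h3.mul (hcont.integral_hasStrictDerivAt 0 x).hasDerivAt).congr_deriv ?_
  have : Real.exp (β * x) * Real.exp (-β * x) = 1 := by rw [← Real.exp_add]; simp
  rw [expConv]
  linear_combination g x * this

lemma ExpGrowth.expConv (β : ℝ) {g : ℝ → ℝ} (hg : ExpGrowth g) : ExpGrowth (expConv β g) := by
  obtain ⟨C, c, hC, hc, h⟩ := hg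
  refine ⟨C, |β| + (|β| + c + 1), hC, by positivity, fun x => ?_⟩
  have h1 : ‖∫ y in (0 : ℝ)..x, Real.exp (-β * y) * g y‖
      ≤ C * Real.exp ((|β| + c) * |x|) * |x - 0| := by
    refine intervalIntegral.norm_integral_le_of_norm_le_const fun y hy => ?_
    have hyx : |y| ≤ |x| := by
      rcases le_total 0 x with hx | hx
      · rw [uIoc_of_le hx] at hy
        rw [abs_of_pos hy.1, abs_of_nonneg hx]; exact hy.2
      · rw [uIoc_of_ge hx] at hy
        rw [abs_of_nonpos hy.2, abs_of_nonpos hx]; linarith [hy.1]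
    rw [Real.norm_eq_abs, abs_mul, Real.abs_exp]
    have e1 : -β * y ≤ |β| * |x| := by
      calc -β * y ≤ |-β * y| := le_abs_self _
        _ = |β| * |y| := by rw [abs_mul, abs_neg]
        _ ≤ _ := by gcongr
    calc Real.exp (-β * y) * |g y| ≤ Real.exp (|β| * |x|) * (C * Real.exp (c * |x|)) := by
          refine mul_le_mul (Real.exp_le_exp.2 e1) ((h y).trans ?_) (abs_nonneg _)
            (Real.exp_pos _).le
          gcongr
      _ = _ := by rw [add_mul, Real.exp_add]; ring
  have e2 : Real.exp (β * x) ≤ Real.exp (|β| * |x|) := by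
    rw [← abs_mul]; exact Real.exp_le_exp.2 (le_abs_self _)
  rw [_root_.expConv, abs_mul, Real.abs_exp]
  rw [sub_zero, Real.norm_eq_abs] at h1
  calc _ ≤ Real.exp (|β| * |x|) * (C * Real.exp ((|β| + c) * |x|) * |x|) := by gcongr
    _ = C * Real.exp (|β| * |x|) * (|x| * Real.exp ((|β| + c) * |x|)) := by ring
    _ ≤ C * Real.exp (|β| * |x|) * Real.exp ((|β| + c + 1) * |x|) := by
        gcongr; exact abs_mul_exp_le _ _
    _ = _ := by rw [add_mul |β|, Real.exp_add]; ring

/-! ### Exponential moment and comparison of Gaussian averages -/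

lemma gaussAvg_exp (ν σ x : ℝ) {t : ℝ} (ht : 0 ≤ t) :
    gaussAvg ν σ Real.exp t x = Real.exp (x + (ν + σ ^ 2 / 2) * t) := by
  have h := mgf_gaussianReal (p := gaussianReal 0 1) (X := id) (Measure.map_id) (σ * √t)
  simp only [mgf, id, zero_mul, NNReal.coe_one, one_mul, zero_add] at h
  simp only [gaussAvg, Real.exp_add _ (σ * √t * _)]
  rw [integral_const_mul, h, ← Real.exp_add, mul_pow, Real.sq_sqrt ht]
  congr 1
  ring

instance : (gaussianReal 0 1).IsOpenPosMeasure :=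
  (gaussianReal_absolutelyContinuous' 0 one_ne_zero).isOpenPosMeasure

/-- By continuity and the full support of the Gaussian, one strict point suffices. The shifted form
serves both for two functions from one starting point and for one function from two starting points.
-/
lemma gaussAvg_lt {ν σ : ℝ} (hσ : σ ≠ 0) {f g : ℝ → ℝ} (hf : Continuous f) (hfg : ExpGrowth f)
    (hg : Continuous g) (hgg : ExpGrowth g) {t x y : ℝ} (ht : 0 < t)
    (hle : ∀ s, f (x + s) ≤ g (y + s)) {s₀ : ℝ} (hlt : f (x + s₀) < g (y + s₀)) :
    gaussAvg ν σ f t x < gaussAvg ν σ g t y := by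
  have i1 := integrable_of_expGrowth hf hfg (x + ν * t) (σ * √t)
  have i2 := integrable_of_expGrowth hg hgg (y + ν * t) (σ * √t)
  have hs : 0 < √t := Real.sqrt_pos.2 ht
  rw [← sub_pos, gaussAvg, gaussAvg, ← integral_sub i2 i1]
  refine integral_pos_of_integrable_nonneg_nonzero (x := (s₀ - ν * t) / (σ * √t))
    (by fun_prop) (i2.sub i1) (fun z => ?_) ?_
  · have := hle (ν * t + σ * √t * z)
    simp only [← add_assoc] at this
    exact sub_nonneg.2 this
  · have e : σ * √t * ((s₀ - ν * t) / (σ * √t)) = s₀ - ν * t := by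
      field_simp
    rw [e, show y + ν * t + (s₀ - ν * t) = y + s₀ by ring,
      show x + ν * t + (s₀ - ν * t) = x + s₀ by ring]
    linarith

lemma gaussAvg_le {ν σ : ℝ} {f g : ℝ → ℝ} (hf : Continuous f) (hfg : ExpGrowth f)
    (hg : Continuous g) (hgg : ExpGrowth g) {t x y : ℝ}
    (hle : ∀ s, f (x + s) ≤ g (y + s)) :
    gaussAvg ν σ f t x ≤ gaussAvg ν σ g t y := by
  refine integral_mono (integrable_of_expGrowth hf hfg _ _) (integrable_of_expGrowth hg hgg _ _)
    fun z => ?_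
  simpa only [add_assoc] using hle (ν * t + σ * √t * z)

/-! ### The project value and its smooth-pasting defect -/

namespace Market

/-- The project value for a general profit `f` during the contract. -/
noncomputable def contractValue (m : Market) (f : ℝ → ℝ) (p : ℝ) : ℝ :=
  (∫ t in (0 : ℝ)..m.T, Real.exp (-m.r * t) * m.expect f p t) +
    ∫ t in Set.Ioi m.T, Real.exp (-m.r * t) * m.expect (fun x => x * m.Q) p t

/-- The drift of the logarithm of the price. -/
noncomputable def logDrift (m : Market) : ℝ := m.μ - m.σ ^ 2 / 2

/-- The absolute value of the negative root of `σ²/2 β (β - 1) + μ β - r = 0`. -/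
noncomputable def kappa (m : Market) : ℝ :=
  √((-1 / 2 + m.μ / m.σ ^ 2) ^ 2 + 2 * m.r / m.σ ^ 2) - (1 / 2 - m.μ / m.σ ^ 2)

variable {m : Market}

lemma abs_lt_sqrt_discr (hσ : 0 < m.σ) (hr : 0 < m.r) :
    |-1 / 2 + m.μ / m.σ ^ 2| < √((-1 / 2 + m.μ / m.σ ^ 2) ^ 2 + 2 * m.r / m.σ ^ 2) := by
  rw [← Real.sqrt_sq_eq_abs]
  refine Real.sqrt_lt_sqrt (sq_nonneg _) ?_
  have : 0 < 2 * m.r / m.σ ^ 2 := by positivity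
  linarith

lemma kappa_pos (hσ : 0 < m.σ) (hr : 0 < m.r) : 0 < m.kappa := by
  have h := abs_lt_sqrt_discr hσ hr
  have := neg_abs_le (-1 / 2 + m.μ / m.σ ^ 2)
  rw [kappa]
  linarith

lemma beta_pos (hσ : 0 < m.σ) (hr : 0 < m.r) : 0 < m.beta := by
  have h := abs_lt_sqrt_discr hσ hr
  have := le_abs_self (-1 / 2 + m.μ / m.σ ^ 2)
  rw [beta]
  linarith

lemma eta_zero : m.eta 0 = m.beta := by simp [eta, beta]

lemma eta_lt_eta (hσ : 0 < m.σ) (hr : 0 < m.r) {a b : ℝ} (ha : 0 ≤ a) (hab : a < b) :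
    m.eta a < m.eta b := by
  have : √((-1 / 2 + m.μ / m.σ ^ 2) ^ 2 + 2 * (m.r + a) / m.σ ^ 2)
      < √((-1 / 2 + m.μ / m.σ ^ 2) ^ 2 + 2 * (m.r + b) / m.σ ^ 2) := by
    refine Real.sqrt_lt_sqrt (by positivity) ?_
    gcongr
  rw [eta, eta]
  linarith

/-- With `beta_mul_kappa`, these are Vieta's relations for the roots `β` and `-κ` of the
characteristic polynomial in the variable `log p`. -/
lemma beta_sub_kappa (hσ : 0 < m.σ) :
    m.σ ^ 2 / 2 * (m.beta - m.kappa) = -m.logDrift := by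
  rw [beta, kappa, logDrift]
  field_simp
  ring

lemma beta_mul_kappa (hσ : 0 < m.σ) (hr : 0 < m.r) : m.σ ^ 2 / 2 * (m.beta * m.kappa) = m.r := by
  have h : m.beta * m.kappa = √((-1 / 2 + m.μ / m.σ ^ 2) ^ 2 + 2 * m.r / m.σ ^ 2) ^ 2
      - (1 / 2 - m.μ / m.σ ^ 2) ^ 2 := by rw [beta, kappa]; ring
  rw [h, Real.sq_sqrt (by positivity)]
  field_simp
  ring

lemma expect_exp (f : ℝ → ℝ) (x t : ℝ) :
    m.expect f (Real.exp x) t = gaussAvg m.logDrift m.σ (fun y => f (Real.exp y)) t x := by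
  simp only [expect, gaussAvg, price, logDrift, ← Real.exp_add, add_assoc]

lemma expect_mul (x : ℝ) {t : ℝ} (ht : 0 ≤ t) :
    m.expect (fun p => p * m.Q) (Real.exp x) t = m.Q * Real.exp x * Real.exp (m.μ * t) := by
  have h := gaussAvg_exp m.logDrift m.σ x ht
  rw [expect_exp, gaussAvg, integral_mul_const]
  rw [gaussAvg] at h
  rw [h, Real.exp_add, logDrift, sub_add_cancel]
  ring

lemma integral_market_profit (hμ : m.μ < m.r) (hT : 0 < m.T) (x : ℝ) :
    ∫ t in Ioi m.T, Real.exp (-m.r * t) * m.expect (fun p => p * m.Q) (Real.exp x) t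
      = m.Q * Real.exp (-m.r * m.T) / (m.r - m.μ) * Real.exp (x + m.μ * m.T) := by
  have h : ∀ t ∈ Ioi m.T, Real.exp (-m.r * t) * m.expect (fun p => p * m.Q) (Real.exp x) t
      = m.Q * Real.exp x * Real.exp ((m.μ - m.r) * t) := fun t ht => by
    rw [expect_mul x (hT.trans ht).le, sub_mul, sub_eq_neg_add, Real.exp_add, neg_mul]
    ring
  rw [setIntegral_congr_fun measurableSet_Ioi h, integral_const_mul,
    integral_exp_mul_Ioi (by linarith), Real.exp_add x,
    show (m.μ - m.r) * m.T = -m.r * m.T + m.μ * m.T by ring, Real.exp_add (-m.r * m.T)]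
  have : m.r - m.μ ≠ 0 := by linarith
  have h2 : m.μ - m.r ≠ 0 := by linarith
  field_simp
  ring

section contract

variable {f g : ℝ → ℝ}

lemma continuous_exp_comp (hQ : 0 < m.Q) (hf : IsPayoff m.Q f) :
    Continuous fun y => f (Real.exp y) :=
  (hf.continuous hQ.le).comp Real.continuous_exp

lemma expGrowth_exp_comp (hQ : 0 < m.Q) (hf : IsPayoff m.Q f) :
    ExpGrowth fun y => f (Real.exp y) :=
  expGrowth_of_le (abs_nonneg _) hQ.le hf.abs_exp_le

/-- The smooth-pasting defect of the project value decreases in the price. -/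
lemma strictAntiOn_defect (hσ : 0 < m.σ) (hr : 0 < m.r) (hμ : m.μ < m.r) (hQ : 0 < m.Q)
    (hT : 0 < m.T) (hf : IsPayoff m.Q f) :
    ∃ v' : ℝ → ℝ, (∀ p, 0 < p → HasDerivAt (m.contractValue f) (v' p) p) ∧
      StrictAntiOn (fun p => p * v' p - m.beta * m.contractValue f p) (Ioi 0) := by
  set β := m.beta with hβ
  set k := m.kappa with hk
  set ν := m.logDrift with hν
  have hk0 : 0 < k := kappa_pos hσ hr
  have hk1 : 0 < k + 1 := by linarith
  have hβk : m.σ ^ 2 / 2 * (β - k) = -ν := beta_sub_kappa hσ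
  have hβk' : m.σ ^ 2 / 2 * (β * k) = m.r := beta_mul_kappa hσ hr
  have hσ2 : 0 < 2 / m.σ ^ 2 := by positivity
  have hσc : m.σ ^ 2 / 2 * (2 / m.σ ^ 2) = 1 := by field_simp
  set F : ℝ → ℝ := fun y => f (Real.exp y) with hF
  have hFc : Continuous F := continuous_exp_comp hQ hf
  have hFb : ∀ x, |F x| ≤ |f 0| + m.Q * Real.exp x := hf.abs_exp_le
  have hFg : ExpGrowth F := expGrowth_exp_comp hQ hf
  set M := kernelAvg k F with hM
  have hMd : ∀ x, HasDerivAt M (F x - k * M x) x := hasDerivAt_kernelAvg hk0 hFc hFb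
  have hMc : Continuous M := continuous_iff_continuousAt.2 fun x => (hMd x).continuousAt
  have hMg : ExpGrowth M :=
    expGrowth_of_le (by positivity) (by positivity) (abs_kernelAvg_le hk0 hFb)
  have hMm : Monotone M := kernelAvg_mono hk0 hFc hFb fun x y h => hf.mono (Real.exp_le_exp.2 h)
  set G : ℝ → ℝ := fun x => m.Q / (k + 1) * Real.exp x - M x with hG
  have hGc : Continuous G := by fun_prop
  have hGg : ExpGrowth G := by
    have := (ExpGrowth.exp.const_mul (m.Q / (k + 1))).add (hMg.const_mul (-1))
    convert this using 2
    simp only [hG]; ring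
  have hGm : Monotone G := by
    have e : G = kernelAvg k fun y => Real.exp y * m.Q - F y :=
      funext fun x => (kernelAvg_const_mul_exp_sub hk0 hFc hFb m.Q x).symm
    rw [e]
    refine kernelAvg_mono (a := |f 0|) (b := m.Q + m.Q) hk0 (by fun_prop) (fun x => ?_)
      fun x y h => hf.gap (Real.exp_le_exp.2 h)
    refine (abs_sub _ _).trans ?_
    rw [abs_mul, Real.abs_exp, abs_of_pos hQ]
    linarith [hFb x]
  -- Solves the first factor: `σ²/2 (n' + k n) = -F`. Next, `w' - β w = n` solves the second. Any
  -- solution `w` of exponential growth will do, since adding a multiple of `e^(βx)` does not change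
  -- `w - e^(-rT) E w(X_T)`.
  set n : ℝ → ℝ := fun x => -(2 / m.σ ^ 2) * M x with hn
  have hnd : ∀ x, HasDerivAt n (-(2 / m.σ ^ 2) * (F x - k * M x)) x := fun x =>
    (hMd x).const_mul _
  have hnc : Continuous n := by fun_prop
  have hng : ExpGrowth n := hMg.const_mul _
  set w := expConv β n with hw
  have hwd : ∀ x, HasDerivAt w (β * w x + n x) x := hasDerivAt_expConv β hnc
  have hwc : Continuous w := continuous_iff_continuousAt.2 fun x => (hwd x).continuousAt
  have hwg : ExpGrowth w := hng.expConv β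
  have hwd' : ∀ x, HasDerivAt (fun x => β * w x + n x)
      (β * (β * w x + n x) + -(2 / m.σ ^ 2) * (F x - k * M x)) x := fun x =>
    ((hwd x).const_mul β).add (hnd x)
  have hw'g : ExpGrowth fun x => β * w x + n x := (hwg.const_mul β).add hng
  have hw''g : ExpGrowth fun x =>
      β * (β * w x + n x) + -(2 / m.σ ^ 2) * (F x - k * M x) := by
    have := (hw'g.const_mul β).add
      ((hFg.add (hMg.const_mul (-k))).const_mul (-(2 / m.σ ^ 2)))
    convert this using 4
    ring
  have dyn := fun x => integral_discounted_gaussAvg (ν := ν) (σ := m.σ) hwd hwd' (by fun_prop)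
    hwg hw'g hw''g m.r (f := F) (fun y => by
      simp only [hn]
      linear_combination (β * w y - 2 / m.σ ^ 2 * M y) * hβk + w y * hβk' - F y * hσc)
      hT.le x
  set c := m.Q * Real.exp (-m.r * m.T) / (m.r - m.μ) with hc
  have hv : ∀ x, m.contractValue f (Real.exp x)
      = w x - Real.exp (-m.r * m.T) * gaussAvg ν m.σ w m.T x
        + c * Real.exp (x + m.μ * m.T) := fun x => by
    rw [contractValue, integral_market_profit hμ hT, ← dyn x]
    simp only [expect_exp, ← hF, ← hν, hc]
  set D : ℝ → ℝ := fun x => β * w x + n x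
    - Real.exp (-m.r * m.T) * gaussAvg ν m.σ (fun x => β * w x + n x) m.T x
    + c * Real.exp (x + m.μ * m.T) with hD
  have hvd : ∀ x, HasDerivAt (fun x => m.contractValue f (Real.exp x)) (D x) x := fun x => by
    rw [show (fun x => m.contractValue f (Real.exp x)) = _ from funext hv]
    refine ((hwd x).sub ((hasDerivAt_gaussAvg_space hwd (by fun_prop) hwg hw'g m.T x).const_mul
      _)).add ?_
    have := (((hasDerivAt_id x).add_const (m.μ * m.T)).exp).const_mul c
    exact this.congr_deriv (by simp)
  refine ⟨fun p => D (Real.log p) * p⁻¹, fun p hp => ?_, fun p hp q hq hpq => ?_⟩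
  · have h1 := (hvd (Real.log p)).comp p (Real.hasDerivAt_log hp.ne')
    refine h1.congr_of_eventuallyEq ?_
    filter_upwards [Ioi_mem_nhds hp] with q hq
    simp [Real.exp_log hq]
  -- Applying `d/dx - β` to the value turns each `w` into `n`. The term `-e^(-rT) E M(X_T)` has the
  -- wrong sign for monotonicity, but the market profit after `T` completes it to `e^(-rT) E
  -- G(X_T)`.
  · have hW : ∀ p, 0 < p → p * (D (Real.log p) * p⁻¹) - β * m.contractValue f p
        = -(2 / m.σ ^ 2) * (M (Real.log p)
          + Real.exp (-m.r * m.T) * gaussAvg ν m.σ G m.T (Real.log p)) := fun p hp => by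
      have e1 : m.contractValue f p = m.contractValue f (Real.exp (Real.log p)) := by
        rw [Real.exp_log hp]
      rw [e1, hv, mul_comm p, mul_assoc, inv_mul_cancel₀ hp.ne', mul_one]
      set x := Real.log p
      have iw := integrable_of_expGrowth hwc hwg (x + ν * m.T) (m.σ * √m.T)
      have iM := integrable_of_expGrowth hMc hMg (x + ν * m.T) (m.σ * √m.T)
      have ie := integrable_of_expGrowth Real.continuous_exp ExpGrowth.exp
        (x + ν * m.T) (m.σ * √m.T)
      have e2 : gaussAvg ν m.σ (fun x => β * w x + n x) m.T x
          = β * gaussAvg ν m.σ w m.T x + -(2 / m.σ ^ 2) * gaussAvg ν m.σ M m.T x := by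
        simp only [gaussAvg, hn]
        rw [integral_add (iw.const_mul β) (iM.const_mul _), integral_const_mul,
          integral_const_mul]
      have e3 : gaussAvg ν m.σ G m.T x
          = m.Q / (k + 1) * Real.exp (x + m.μ * m.T) - gaussAvg ν m.σ M m.T x := by
        have e4 := gaussAvg_exp ν m.σ x hT.le
        rw [hν, logDrift, sub_add_cancel, ← logDrift, ← hν] at e4
        rw [← e4]
        simp only [gaussAvg, hG]
        rw [integral_sub (ie.const_mul _) iM, integral_const_mul]
      -- The characteristic polynomial at `1` equals `μ - r`, so `σ²/2 (β - 1)(k + 1) = r - μ`,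
      -- which cancels the denominator of `c`.
      have e5 : (1 - β) * c = -(2 / m.σ ^ 2) * (Real.exp (-m.r * m.T) * (m.Q / (k + 1))) := by
        have h1 : m.r - m.μ ≠ 0 := by linarith
        have h2 : (β - 1) * (k + 1) = 2 / m.σ ^ 2 * (m.r - m.μ) := by
          have h3 : m.σ ^ 2 / 2 * ((β - 1) * (k + 1)) = m.r - m.μ := by
            rw [hν, logDrift] at hβk
            linear_combination hβk + hβk'
          rw [← h3, ← mul_assoc, mul_comm (2 / m.σ ^ 2), hσc, one_mul]
        rw [hc]
        field_simp
        field_simp at h2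
        linear_combination (-1) * h2
      rw [e3]
      simp only [hD]
      rw [e2]
      simp only [hn]
      linear_combination Real.exp (x + m.μ * m.T) * e5
    have hp' : 0 < p := hp
    have hq' : 0 < q := hq
    have hxy : Real.log p < Real.log q := Real.log_lt_log hp' hpq
    simp only
    rw [hW p hp', hW q hq']
    set x := Real.log p
    set y := Real.log q
    have hE : 0 < Real.exp (-m.r * m.T) := Real.exp_pos _
    suffices h : M x + Real.exp (-m.r * m.T) * gaussAvg ν m.σ G m.T x
        < M y + Real.exp (-m.r * m.T) * gaussAvg ν m.σ G m.T y by
      exact mul_lt_mul_of_neg_left h (neg_lt_zero.2 hσ2)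
    have hGle : ∀ s, G (x + s) ≤ G (y + s) := fun s => hGm (by linarith)
    -- `M` and `G` add up to a multiple of `e^x`, so they cannot both be constant from `x` to `y`.
    rcases (hMm hxy.le).lt_or_eq with h | h
    · exact add_lt_add_of_lt_of_le h
        (mul_le_mul_of_nonneg_left (gaussAvg_le hGc hGg hGc hGg hGle) hE.le)
    · refine add_lt_add_of_le_of_lt h.le (mul_lt_mul_of_pos_left
        (gaussAvg_lt hσ.ne' hGc hGg hGc hGg hT hGle (s₀ := 0) ?_) hE)
      simp only [add_zero, hG, h]
      gcongr

lemma contractValue_lt (hσ : 0 < m.σ) (hQ : 0 < m.Q) (hT : 0 < m.T) (hf : IsPayoff m.Q f)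
    (hg : IsPayoff m.Q g) (hle : ∀ p, 0 < p → f p ≤ g p) {p₀ : ℝ} (hp₀ : 0 < p₀)
    (hlt : f p₀ < g p₀) {p : ℝ} (hp : 0 < p) :
    m.contractValue f p < m.contractValue g p := by
  obtain ⟨x, rfl⟩ : ∃ x, p = Real.exp x := ⟨_, (Real.exp_log hp).symm⟩
  obtain ⟨x₀, rfl⟩ : ∃ x, p₀ = Real.exp x := ⟨_, (Real.exp_log hp₀).symm⟩
  have cf := continuous_exp_comp hQ hf
  have cg := continuous_exp_comp hQ hg
  have ef := expGrowth_exp_comp hQ hf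
  have eg := expGrowth_exp_comp hQ hg
  have cf' := continuous_gaussAvg (ν := m.logDrift) (σ := m.σ) cf ef x
  have cg' := continuous_gaussAvg (ν := m.logDrift) (σ := m.σ) cg eg x
  refine add_lt_add_of_lt_of_le ?_ le_rfl
  simp only [expect_exp]
  have i1 : IntervalIntegrable (fun t => Real.exp (-m.r * t)
      * gaussAvg m.logDrift m.σ (fun y => f (Real.exp y)) t x) volume 0 m.T :=
    Continuous.intervalIntegrable (by fun_prop) _ _
  have i2 : IntervalIntegrable (fun t => Real.exp (-m.r * t)
      * gaussAvg m.logDrift m.σ (fun y => g (Real.exp y)) t x) volume 0 m.T :=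
    Continuous.intervalIntegrable (by fun_prop) _ _
  rw [← sub_pos, ← intervalIntegral.integral_sub i2 i1]
  refine intervalIntegral.intervalIntegral_pos_of_pos_on (i2.sub i1) (fun t ht => ?_) hT
  rw [sub_pos]
  refine mul_lt_mul_of_pos_left (gaussAvg_lt hσ.ne' cf ef cg eg ht.1
    (fun s => hle _ (Real.exp_pos _)) (s₀ := x₀ - x) ?_) (Real.exp_pos _)
  simpa using hlt

lemma contractValue_le (hσ : 0 < m.σ) (hQ : 0 < m.Q) (hT : 0 < m.T) (hf : IsPayoff m.Q f)
    (hg : IsPayoff m.Q g) (hle : ∀ p, 0 < p → f p ≤ g p) {p : ℝ} (hp : 0 < p) :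
    m.contractValue f p ≤ m.contractValue g p := by
  by_cases h : ∃ p₀, 0 < p₀ ∧ f p₀ < g p₀
  · obtain ⟨p₀, hp₀, hlt⟩ := h
    exact (contractValue_lt hσ hQ hT hf hg hle hp₀ hlt hp).le
  · push Not at h
    have e : ∀ p, 0 < p → f p = g p := fun p hp => le_antisymm (hle p hp) (h p hp)
    have e' : ∀ t, m.expect f p t = m.expect g p t := fun t => by
      simp only [expect]
      congr 1
      ext z
      exact e _ (mul_pos hp (Real.exp_pos _))
    simp only [contractValue, e', le_refl]

end contract

end Market

/-! ### The four schemes are payoffs -/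

lemma Scheme.isPayoff_profit (S : Scheme) {Q : ℝ} (hQ : 0 < Q) (F C : ℝ) :
    IsPayoff Q fun p => S.profit Q F C p := by
  cases S
  · exact ⟨fun p q h => le_rfl, fun p q h => by simp only [Scheme.profit]; gcongr⟩
  · exact ⟨fun p q h => by simp only [Scheme.profit]; gcongr,
      fun p q h => by simp only [Scheme.profit]; linarith⟩
  · refine ⟨fun p q h => by simp only [Scheme.profit]; gcongr, fun p q h => ?_⟩
    simp only [Scheme.profit, ← sub_mul]
    gcongr 1
    grind
  · refine ⟨fun p q h => by simp only [Scheme.profit]; gcongr, fun p q h => ?_⟩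
    simp only [Scheme.profit, ← sub_mul]
    gcongr 1
    grind

/-! ### Unimodality of the excess of investing over waiting -/

section Waiting

variable {β A I P : ℝ} {v v' : ℝ → ℝ}

/-- Formally `(p^(-β) p v')' = p^(-β) W'`. To avoid a second derivative of `v`, write `p v' = β v +
W` and freeze `W` at the left endpoint: the frozen expression has a derivative with the sign of `W s
- W p`. -/
lemma strictAntiOn_rpow_mul_deriv (hβ : 0 < β) (hv : ∀ p, 0 < p → HasDerivAt v (v' p) p)
    (hW : StrictAntiOn (fun p => p * v' p - β * v p) (Ioi 0)) :
    StrictAntiOn (fun p => p ^ (-β) * (p * v' p)) (Ioi 0) := by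
  intro p hp q hq hpq
  have hp : 0 < p := hp
  have hq : 0 < q := hq
  set W : ℝ → ℝ := fun p => p * v' p - β * v p with hWd
  have hd : ∀ s, 0 < s → HasDerivAt (fun s => s ^ (-β) * (β * v s + W p))
      (β * s ^ (-β - 1) * (W s - W p)) s := fun s hs => by
    have h1 := (Real.hasDerivAt_rpow_const (p := -β) (Or.inl hs.ne')).mul
      (((hv s hs).const_mul β).add_const (W p))
    refine h1.congr_deriv ?_
    have h2 : s ^ (-β) = s ^ (-β - 1) * s := by
      rw [Real.rpow_sub_one hs.ne', div_mul_cancel₀ _ hs.ne']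
    rw [h2]
    simp only [hWd]
    ring
  have hanti : AntitoneOn (fun s => s ^ (-β) * (β * v s + W p)) (Icc p q) := by
    refine antitoneOn_of_hasDerivWithinAt_nonpos (convex_Icc p q)
      (fun s hs => (hd s (hp.trans_le hs.1)).continuousAt.continuousWithinAt)
      (fun s hs => (hd s ?_).hasDerivWithinAt) (fun s hs => ?_)
    all_goals rw [interior_Icc] at hs
    · exact hp.trans hs.1
    · have hs0 : 0 < s := hp.trans hs.1
      exact mul_nonpos_of_nonneg_of_nonpos (by positivity)
        (sub_nonpos.2 (hW hp hs0 hs.1).le)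
  have h1 := hanti (left_mem_Icc.2 hpq.le) (right_mem_Icc.2 hpq.le) hpq.le
  have h2 : W q < W p := hW hp hq hpq
  have h3 : 0 < q ^ (-β) := Real.rpow_pos_of_pos hq _
  simp only at h1 ⊢
  calc q ^ (-β) * (q * v' q) = q ^ (-β) * (β * v q + W q) := by simp only [hWd]; ring
    _ < q ^ (-β) * (β * v q + W p) := by gcongr
    _ ≤ p ^ (-β) * (β * v p + W p) := h1
    _ = _ := by simp only [hWd]; ring

lemma hasDerivAt_sub_rpow {p : ℝ} (hv : HasDerivAt v (v' p) p) (hp : 0 < p) :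
    HasDerivAt (fun p => v p - I - A * p ^ β) ((p * v' p - β * A * p ^ β) / p) p := by
  refine ((hv.sub_const I).sub ((Real.hasDerivAt_rpow_const (p := β)
    (Or.inl hp.ne')).const_mul A)).congr_deriv ?_
  rw [Real.rpow_sub_one hp.ne']
  field_simp

/-- Cross-multiplied form of the strict decrease of `p u' / p^β` for `u = v - I - A p^β`; the term
in `A` contributes only a constant. Thus `u'` can change sign only once, from positive to negative.
-/
lemma slope_lt (hβ : 0 < β) (hv : ∀ p, 0 < p → HasDerivAt v (v' p) p)
    (hW : StrictAntiOn (fun p => p * v' p - β * v p) (Ioi 0)) {p q : ℝ} (hp : 0 < p)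
    (hpq : p < q) :
    p ^ β * (q * v' q - β * A * q ^ β) < q ^ β * (p * v' p - β * A * p ^ β) := by
  refine lt_of_mul_lt_mul_left ?_ (Real.rpow_pos_of_pos hp (-β)).le
  have hq := hp.trans hpq
  have h := strictAntiOn_rpow_mul_deriv hβ hv hW hp hq hpq
  simp only at h
  have hp1 : p ^ (-β) * p ^ β = 1 := by rw [← Real.rpow_add hp]; simp
  have hq1 : q ^ (-β) * q ^ β = 1 := by rw [← Real.rpow_add hq]; simp
  have hq2 : 0 < q ^ β := Real.rpow_pos_of_pos hq _
  have h' := mul_lt_mul_of_pos_left h hq2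
  have e1 : p ^ (-β) * (q ^ β * (p * v' p - β * A * p ^ β))
      = q ^ β * (p ^ (-β) * (p * v' p)) - β * A * q ^ β := by
    linear_combination (-(β * A * q ^ β)) * hp1
  have e2 : p ^ (-β) * (p ^ β * (q * v' q - β * A * q ^ β))
      = q ^ β * (q ^ (-β) * (q * v' q)) - β * A * q ^ β := by
    linear_combination (q * v' q - β * A * q ^ β) * hp1 - q * v' q * hq1
  rw [e1, e2]
  linarith

lemma slope_pos_of_lt (hβ : 0 < β) (hv : ∀ p, 0 < p → HasDerivAt v (v' p) p)
    (hW : StrictAntiOn (fun p => p * v' p - β * v p) (Ioi 0)) {p q : ℝ} (hp : 0 < p)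
    (hpq : p < q) (h : 0 ≤ q * v' q - β * A * q ^ β) : 0 < p * v' p - β * A * p ^ β := by
  have h1 := slope_lt (A := A) hβ hv hW hp hpq
  have h2 : 0 < p ^ β := Real.rpow_pos_of_pos hp _
  have h3 : 0 < q ^ β := Real.rpow_pos_of_pos (hp.trans hpq) _
  exact pos_of_mul_pos_right ((mul_nonneg h2.le h).trans_lt h1) h3.le

lemma slope_neg_of_lt (hβ : 0 < β) (hv : ∀ p, 0 < p → HasDerivAt v (v' p) p)
    (hW : StrictAntiOn (fun p => p * v' p - β * v p) (Ioi 0)) {p q : ℝ} (hp : 0 < p)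
    (hpq : p < q) (h : p * v' p - β * A * p ^ β ≤ 0) : q * v' q - β * A * q ^ β < 0 := by
  by_contra! h'
  exact (slope_pos_of_lt hβ hv hW hp hpq h').not_ge h

lemma strictMonoOn_sub_rpow (hβ : 0 < β) (hv : ∀ p, 0 < p → HasDerivAt v (v' p) p)
    (hW : StrictAntiOn (fun p => p * v' p - β * v p) (Ioi 0))
    (h : 0 ≤ P * v' P - β * A * P ^ β) :
    StrictMonoOn (fun p => v p - I - A * p ^ β) (Ioc 0 P) := by
  refine strictMonoOn_of_hasDerivWithinAt_pos (convex_Ioc 0 P)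
    (fun p hp => (hasDerivAt_sub_rpow (hv p hp.1) hp.1).continuousAt.continuousWithinAt)
    (fun p hp => (hasDerivAt_sub_rpow (hv p ?_) ?_).hasDerivWithinAt) (fun p hp => ?_)
  all_goals rw [interior_Ioc] at hp
  · exact hp.1
  · exact hp.1
  · exact div_pos (slope_pos_of_lt hβ hv hW hp.1 hp.2 h) hp.1

lemma strictAntiOn_sub_rpow (hβ : 0 < β) (hv : ∀ p, 0 < p → HasDerivAt v (v' p) p)
    (hW : StrictAntiOn (fun p => p * v' p - β * v p) (Ioi 0)) (hP : 0 < P)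
    (h : P * v' P - β * A * P ^ β ≤ 0) :
    StrictAntiOn (fun p => v p - I - A * p ^ β) (Ici P) := by
  have hpos : ∀ p ∈ Ici P, 0 < p := fun p hp => hP.trans_le hp
  refine strictAntiOn_of_hasDerivWithinAt_neg (convex_Ici P)
    (fun p hp => (hasDerivAt_sub_rpow (hv p (hpos p hp)) (hpos p hp)).continuousAt.continuousWithinAt)
    (fun p hp => (hasDerivAt_sub_rpow (hv p ?_) ?_).hasDerivWithinAt) (fun p hp => ?_)
  all_goals rw [interior_Ici] at hp
  · exact hP.trans hp
  · exact hP.trans hp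
  · exact div_neg_of_neg_of_pos (slope_neg_of_lt hβ hv hW hP hp h) (hP.trans hp)

end Waiting

/-! ### Thresholds and the constant in the value of waiting -/

namespace Market

variable {m : Market} {S : Scheme} {F C A P : ℝ}

lemma exists_deriv_projectValue (hσ : 0 < m.σ) (hr : 0 < m.r) (hμ : m.μ < m.r) (hQ : 0 < m.Q)
    (hT : 0 < m.T) (S : Scheme) (F C : ℝ) :
    ∃ v' : ℝ → ℝ, (∀ p, 0 < p → HasDerivAt (m.projectValue S F C) (v' p) p) ∧
      StrictAntiOn (fun p => p * v' p - m.beta * m.projectValue S F C p) (Ioi 0) :=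
  strictAntiOn_defect hσ hr hμ hQ hT (S.isPayoff_profit hQ F C)

/-- Waiting is worth at least as much as investing. -/
lemma IsThreshold.le (hσ : 0 < m.σ) (hr : 0 < m.r) (hμ : m.μ < m.r) (hQ : 0 < m.Q)
    (hT : 0 < m.T) (h : m.IsThreshold S F C A P) {p : ℝ} (hp : 0 < p) :
    m.projectValue S F C p - m.I - A * p ^ m.beta ≤ 0 := by
  obtain ⟨v', hv, hW⟩ := exists_deriv_projectValue hσ hr hμ hQ hT S F C
  have hβ := beta_pos hσ hr
  have hP := h.pos
  have hs : P * v' P - m.beta * A * P ^ m.beta = 0 := by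
    rw [(hv P hP).unique h.smooth_pasting, Real.rpow_sub_one hP.ne']
    field_simp
    ring
  have h0 : m.projectValue S F C P - m.I - A * P ^ m.beta = 0 := by
    rw [h.value_matching, sub_self]
  rw [← h0]
  rcases le_total p P with hpP | hpP
  · exact (strictMonoOn_sub_rpow hβ hv hW hs.ge).monotoneOn ⟨hp, hpP⟩ ⟨hP, le_rfl⟩ hpP
  · exact (strictAntiOn_sub_rpow hβ hv hW hP hs.le).antitoneOn self_mem_Ici hpP hpP

/-- The constant in the value of waiting increases with the project value. -/
lemma IsThreshold.const_le {F' C' A' P' : ℝ} (hσ : 0 < m.σ) (hr : 0 < m.r) (hμ : m.μ < m.r)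
    (hQ : 0 < m.Q) (hT : 0 < m.T) (h : m.IsThreshold S F C A P)
    (h' : m.IsThreshold S F' C' A' P')
    (hle : m.projectValue S F C P ≤ m.projectValue S F' C' P) : A ≤ A' := by
  have h1 := h'.le hσ hr hμ hQ hT h.pos
  have h2 := h.value_matching
  exact le_of_mul_le_mul_right (by linarith) (Real.rpow_pos_of_pos h.pos m.beta)

lemma IsThreshold.const_lt {F' C' A' P' : ℝ} (hσ : 0 < m.σ) (hr : 0 < m.r) (hμ : m.μ < m.r)
    (hQ : 0 < m.Q) (hT : 0 < m.T) (h : m.IsThreshold S F C A P)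
    (h' : m.IsThreshold S F' C' A' P')
    (hlt : m.projectValue S F C P < m.projectValue S F' C' P) : A < A' := by
  have h1 := h'.le hσ hr hμ hQ hT h.pos
  have h2 := h.value_matching
  exact lt_of_mul_lt_mul_right (by linarith) (Real.rpow_pos_of_pos h.pos m.beta).le

/-- The excess `u` of the value of investing over the reduced value of waiting `A p ^ β` has
elasticity `η₁` at a threshold under regulatory uncertainty, where it is nonnegative. -/
lemma IsRegThreshold.elasticity {ω ωC lam : ℝ} (hσ : 0 < m.σ) (hr : 0 < m.r) (hlam : 0 < lam)
    (hle : ∀ p, 0 < p → m.projectValue S (ω * F) (ωC * C) p ≤ m.projectValue S F C p)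
    (h : m.IsRegThreshold S F C ω ωC lam P) {v' : ℝ → ℝ}
    (hv : ∀ p, 0 < p → HasDerivAt (m.projectValue S F C) (v' p) p)
    (hW : StrictAntiOn (fun p => p * v' p - m.beta * m.projectValue S F C p) (Ioi 0)) :
    ∃ A P' : ℝ, m.IsThreshold S (ω * F) (ωC * C) A P' ∧ 0 < P ∧ P ≤ P' ∧
      P * v' P - m.beta * A * P ^ m.beta
        = m.eta lam * (m.projectValue S F C P - m.I - A * P ^ m.beta) ∧
      0 ≤ P * v' P - m.beta * A * P ^ m.beta := by
  obtain ⟨A, P', B, hA, hP, hPP, hvm, hsp⟩ := h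
  have hβ := beta_pos hσ hr
  have hη : m.beta < m.eta lam := by rw [← eta_zero]; exact eta_lt_eta hσ hr le_rfl hlam
  have hel : P * v' P - m.beta * A * P ^ m.beta
      = m.eta lam * (m.projectValue S F C P - m.I - A * P ^ m.beta) := by
    rw [(hv P hP).unique hsp, ← hvm, Real.rpow_sub_one hP.ne', Real.rpow_sub_one hP.ne']
    field_simp
    ring
  refine ⟨A, P', hA, hP, hPP, hel, ?_⟩
  -- If `u` decreased at `P`, it would decrease up to `P'`, so `u(P) ≥ u(P')`. But `u(P') ≥ 0`,
  -- because there `A p^β` equals the reduced value minus `I`. Then `P u'(P) = η u(P) ≥ 0`. This is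
  -- where `P ≤ P'` enters.
  by_contra! hneg
  have h1 := (strictAntiOn_sub_rpow (I := m.I) hβ hv hW hP hneg.le).antitoneOn
    self_mem_Ici hPP hPP
  have h2 := hle P' hA.pos
  have h3 := hA.value_matching
  have h4 : 0 ≤ m.projectValue S F C P - m.I - A * P ^ m.beta := by linarith
  have := mul_nonneg (hβ.trans hη).le h4
  linarith

end Market

/-! ### Comparison of profits between contracts -/

lemma Scheme.profit_le (S : Scheme) {Q F C ω ωC p : ℝ} (hQ : 0 < Q) (hF : 0 < F)
    (hC : S = .collar → F ≤ C) (hω : ω ≤ 1) (hωC : ωC ≤ 1) :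
    S.profit Q (ω * F) (ωC * C) p ≤ S.profit Q F C p := by
  have h1 : ω * F ≤ F := mul_le_of_le_one_left hF.le hω
  cases S <;> simp only [Scheme.profit] <;> gcongr
  exact mul_le_of_le_one_left (hF.le.trans (hC rfl)) hωC

lemma Scheme.exists_profit_lt (S : Scheme) {Q F C ω ωC : ℝ} (hQ : 0 < Q) (hF : 0 < F)
    (hC : S = .collar → F ≤ C) (h : ω < 1 ∨ S = .collar ∧ ωC < 1) :
    ∃ p, 0 < p ∧ S.profit Q (ω * F) (ωC * C) p < S.profit Q F C p := by
  rcases h with h | ⟨rfl, h⟩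
  · have h1 : ω * F < F := mul_lt_of_lt_one_left hF h
    have h2 : max (F / 2) (ω * F) < F := max_lt (by linarith) h1
    have h3 : F ≤ max (F / 2) F := le_max_right _ _
    -- Below the tariff the floor `F` binds, so a lower floor shows in the profit.
    refine ⟨F / 2, by linarith, ?_⟩
    cases S <;> simp only [Scheme.profit] <;> refine mul_lt_mul_of_pos_right ?_ hQ
    · exact h1
    · linarith
    · exact h2.trans_le h3
    · exact (min_le_left _ _).trans_lt (h2.trans_le (le_min h3 (hC rfl)))
  · have hC0 : 0 < C := hF.trans_le (hC rfl)
    -- At the price `C ≥ F` the full collar pays exactly its cap.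
    refine ⟨C, hC0, mul_lt_mul_of_pos_right ?_ hQ⟩
    rw [min_eq_right (le_max_left C F)]
    exact (min_le_right _ _).trans_lt (mul_lt_of_lt_one_left hC0 h)

lemma Scheme.profit_le_profit (S : Scheme) {Q F F' C p : ℝ} (hQ : 0 < Q) (h : F ≤ F') :
    S.profit Q F C p ≤ S.profit Q F' C p := by
  cases S <;> simp only [Scheme.profit] <;> gcongr

lemma Scheme.exists_profit_lt_profit (S : Scheme) {Q F F' C : ℝ} (hQ : 0 < Q) (hF : 0 ≤ F)
    (h : F < F') (hC : S = .collar → F' ≤ C) :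
    ∃ p, 0 < p ∧ S.profit Q F C p < S.profit Q F' C p := by
  have h2 : max (F' / 2) F < F' := max_lt (by linarith) h
  have h3 : F' ≤ max (F' / 2) F' := le_max_right _ _
  refine ⟨F' / 2, by linarith, ?_⟩
  cases S <;> simp only [Scheme.profit] <;> refine mul_lt_mul_of_pos_right ?_ hQ
  · exact h
  · linarith
  · exact h2.trans_le h3
  · exact (min_le_left _ _).trans_lt (h2.trans_le (le_min h3 (hC rfl)))

/-! ### Comparative statics -/

theorem mainTheorem1 (m : Market) (hσ : 0 < m.σ) (hr : 0 < m.r) (hμ : m.μ < m.r)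
    (hQ : 0 < m.Q) (hT : 0 < m.T) (S : Scheme) (F C ωC : ℝ) (hF : 0 < F)
    (hC : S = Scheme.collar → F ≤ C) (hωC0 : 0 ≤ ωC) (hωC1 : ωC ≤ 1) :
    (∀ ω : ℝ, 0 ≤ ω → ω ≤ 1 → (S = Scheme.collar → ω * F ≤ ωC * C) →
      ∀ lam₁ lam₂ P₁ P₂ : ℝ, 0 < lam₁ → lam₁ ≤ lam₂ →
        m.IsRegThreshold S F C ω ωC lam₁ P₁ → m.IsRegThreshold S F C ω ωC lam₂ P₂ →
          P₂ ≤ P₁ ∧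
            (lam₁ < lam₂ → (ω < 1 ∨ (S = Scheme.collar ∧ ωC < 1)) → P₂ < P₁)) ∧
    (∀ lam : ℝ, 0 < lam → ∀ ω₁ ω₂ P₁ P₂ : ℝ, 0 ≤ ω₁ → ω₁ < ω₂ → ω₂ ≤ 1 →
      (S = Scheme.collar → ω₂ * F ≤ ωC * C) →
        m.IsRegThreshold S F C ω₁ ωC lam P₁ → m.IsRegThreshold S F C ω₂ ωC lam P₂ →
          P₁ < P₂) := by
  obtain ⟨v', hv, hW⟩ := Market.exists_deriv_projectValue hσ hr hμ hQ hT S F C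
  have hβ := Market.beta_pos hσ hr
  have hpay := fun F C => S.isPayoff_profit hQ F C
  have hred : ∀ ω ≤ 1, ∀ p, 0 < p →
      m.projectValue S (ω * F) (ωC * C) p ≤ m.projectValue S F C p := fun ω hω p hp =>
    Market.contractValue_le hσ hQ hT (hpay _ _) (hpay _ _)
      (fun _ _ => S.profit_le hQ hF hC hω hωC1) hp
  have hη : ∀ lam, 0 < lam → m.beta < m.eta lam := fun lam hlam => by
    rw [← Market.eta_zero]; exact Market.eta_lt_eta hσ hr le_rfl hlam
  refine ⟨fun ω _ hω1 _ lam₁ lam₂ P₁ P₂ hlam₁ hlam h₁ h₂ => ?_,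
    fun lam hlam ω₁ ω₂ P₁ P₂ hω₁ hω hω₂ hcol h₁ h₂ => ?_⟩
  · obtain ⟨A, P₁', hA, hP₁, hPP₁, hel₁, hs₁⟩ :=
      h₁.elasticity hσ hr hlam₁ (hred ω hω1) hv hW
    obtain ⟨A₂, P₂', hA₂, hP₂, hPP₂, hel₂, hs₂⟩ :=
      h₂.elasticity hσ hr (hlam₁.trans_le hlam) (hred ω hω1) hv hW
    -- Both regulatory thresholds refer to the same reduced contract, whose waiting constant is
    -- unique.
    obtain rfl : A = A₂ := le_antisymm (hA.const_le hσ hr hμ hQ hT hA₂ le_rfl)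
      (hA₂.const_le hσ hr hμ hQ hT hA le_rfl)
    have hη₁ := hη lam₁ hlam₁
    have hη₂ : m.eta lam₁ ≤ m.eta lam₂ := by
      rcases hlam.lt_or_eq with h | rfl
      · exact (Market.eta_lt_eta hσ hr hlam₁.le h).le
      · exact le_rfl
    have hle : P₂ ≤ P₁ := by
      by_contra! hlt
      have hu := strictMonoOn_sub_rpow (I := m.I) hβ hv hW hs₂ ⟨hP₁, hlt.le⟩ ⟨hP₂, le_rfl⟩ hlt
      have hw := hW hP₁ hP₂ hlt
      simp only at hu hw
      set u₁ := m.projectValue S F C P₁ - m.I - A * P₁ ^ m.beta with hu₁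
      set u₂ := m.projectValue S F C P₂ - m.I - A * P₂ ^ m.beta with hu₂
      have hu0 : 0 ≤ u₁ := by
        rw [hel₁] at hs₁
        exact nonneg_of_mul_nonneg_right hs₁ (hβ.trans hη₁)
      -- Here `(ηᵢ - β) uᵢ = W(Pᵢ) + β I`. If `P₁ < P₂`, the left side would be larger for `i = 2`
      -- and the right side strictly smaller.
      nlinarith [mul_nonneg (sub_nonneg.2 hη₂) (hu0.trans hu.le),
        mul_pos (sub_pos.2 hη₁) (sub_pos.2 hu)]
    refine ⟨hle, fun hlt hstrict => lt_of_le_of_ne hle ?_⟩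
    -- At a common threshold two different elasticities force `u = 0` and hence `u' = 0`, so `u ≤ 0`
    -- up to `P₁'`. There, however, `u` equals the full minus the reduced value, which is positive
    -- for a real reduction.
    rintro rfl
    have hη₃ := Market.eta_lt_eta hσ hr hlam₁.le hlt
    obtain ⟨p₀, hp₀, hp₀lt⟩ := S.exists_profit_lt hQ hF hC hstrict
    have hlt' : m.projectValue S (ω * F) (ωC * C) P₁' < m.projectValue S F C P₁' :=
      Market.contractValue_lt hσ hQ hT (hpay _ _) (hpay _ _)
        (fun _ _ => S.profit_le hQ hF hC hω1 hωC1) hp₀ hp₀lt hA.pos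
    have hu0 : m.projectValue S F C P₂ - m.I - A * P₂ ^ m.beta = 0 := by
      have : (m.eta lam₂ - m.eta lam₁) * (m.projectValue S F C P₂ - m.I - A * P₂ ^ m.beta) = 0 := by
        linarith
      exact (mul_eq_zero.1 this).resolve_left (by linarith)
    rw [hu0, mul_zero] at hel₁
    have h1 := (strictAntiOn_sub_rpow (I := m.I) hβ hv hW hP₁ hel₁.le).antitoneOn
      self_mem_Ici hPP₁ hPP₁
    have := hA.value_matching
    linarith
  · obtain ⟨A₁, P₁', hA₁, hP₁, hPP₁, hel₁, hs₁⟩ :=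
      h₁.elasticity hσ hr hlam (hred ω₁ (hω.le.trans hω₂)) hv hW
    obtain ⟨A₂, P₂', hA₂, hP₂, hPP₂, hel₂, hs₂⟩ :=
      h₂.elasticity hσ hr hlam (hred ω₂ hω₂) hv hW
    have hFF : ω₁ * F < ω₂ * F := by gcongr
    obtain ⟨p₀, hp₀, hp₀lt⟩ :=
      S.exists_profit_lt_profit hQ (mul_nonneg hω₁ hF.le) hFF hcol
    have hA : A₁ < A₂ := hA₁.const_lt hσ hr hμ hQ hT hA₂
      (Market.contractValue_lt hσ hQ hT (hpay _ _) (hpay _ _)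
        (fun _ _ => S.profit_le_profit hQ hFF.le) hp₀ hp₀lt hA₁.pos)
    by_contra! hle
    -- If `P₂ ≤ P₁`, then `(η - β) u₂(P₂) = W(P₂) + β I ≥ W(P₁) + β I = (η - β) u₁(P₁) ≥ (η - β)
    -- u₁(P₂)`, whereas `A₁ < A₂` gives `u₂(P₂) < u₁(P₂)`.
    have hu := (strictMonoOn_sub_rpow (I := m.I) hβ hv hW hs₁).monotoneOn
      ⟨hP₂, hle⟩ ⟨hP₁, le_rfl⟩ hle
    have hw := hW.antitoneOn hP₂ hP₁ hle
    have hAP : A₁ * P₂ ^ m.beta < A₂ * P₂ ^ m.beta :=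
      mul_lt_mul_of_pos_right hA (Real.rpow_pos_of_pos hP₂ _)
    have hη' := sub_pos.2 (hη lam hlam)
    have h3 := mul_le_mul_of_nonneg_left hu hη'.le
    have h4 := mul_lt_mul_of_pos_left hAP hη'
    nlinarith
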